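/- Let $n\ge 2$ and let $M$ be a compact connected (Hausdorff) smooth $n$-dimensional manifold with boundary $\partial M$, with a smooth Riemannian metric $g$. Let $\gamma=g|_{\partial M}$, let $\nu$ be the outward unit normal of $\partial M$, and let $II_\gamma(X,Y)=g(\nabla_X\nu,Y)$ be the second fundamental form of $\partial M$. For $f\in C^\infty(M)$ set $\mathcal S_g^*(f)=(A_g^*f,\,B_\gamma^*f)$, where $$A_g^*f=-(\Delta_g f)\,g+\mathrm{Hess}_g f-f\,\mathrm{Ric}_g\ \text{ on } M,\qquad B_\gamma^*f=\frac{\partial f}{\partial\nu}\,\gamma-f\,II_\gamma\ \text{ on }\partial M,$$ with $\Delta_g f=\mathrm{tr}_g(\mathrm{Hess}_g f)$. (This is the explicit form of the $L^2$-formal adjoint, applied to pairs $(f,f)$, of the linearization at $g$ of the map $g\mapsto(R_g,2H_\gamma)$, scalar curvature of $M$ and twice the mean curvature of $\partial M$.) If $(M,\partial M,g)$ is Ricci-flat with totally geodesic boundary, that is, $\mathrm{Ric}_g\equiv 0$ on $M$ and $II_\gamma\equiv0$ on $\partial M$, then $$\ker(\mathcal S_g^*)=\{f\in C^\infty(M):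 \mathcal S_g^*(f)=0\}$$ is exactly the set of constant functions on $M$. Conversely, if $\ker(\mathcal S_g^*)$ is exactly the set of constant functions, then $(M,\partial M,g)$ is Ricci-flat with totally geodesic boundary. -/

import Mathlib

open scoped Manifold ContDiff

/-!
Riemannian geometry in local coordinates on an `n`-dimensional smooth manifold `M` with boundary,
modelled on the half-space `{y ∈ ℝⁿ | 0 ≤ y 0}`. All components below are taken in a chart `e` of
the maximal smooth atlas and are functions on `M`, meaningful on the domain `e.source`.
-/

noncomputable section

namespace RiemBdry

/-- A smooth Riemannian metric on the manifold with boundary `M`. -/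
abbrev Metric (n : ℕ) [NeZero n] (M : Type*) [TopologicalSpace M]
    [ChartedSpace (EuclideanHalfSpace n) M] [IsManifold (𝓡∂ n) ∞ M] :=
  Bundle.ContMDiffRiemannianMetric (𝓡∂ n) ∞ (EuclideanSpace ℝ (Fin n))
    (fun x : M => TangentSpace (𝓡∂ n) x)

/-- The coordinate charts: all charts of the maximal smooth atlas of `M`. -/
abbrev Chart (n : ℕ) [NeZero n] (M : Type*) [TopologicalSpace M]
    [ChartedSpace (EuclideanHalfSpace n) M] :=
  {e : OpenPartialHomeomorph M (EuclideanHalfSpace n) //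
    e ∈ IsManifold.maximalAtlas (𝓡∂ n) ∞ M}

variable {n : ℕ} [NeZero n] {M : Type*} [TopologicalSpace M]
  [ChartedSpace (EuclideanHalfSpace n) M]

/-- The coordinate partial derivative `∂ᵢ u`; it is one-sided in the direction `∂₀` at
boundary points. -/
def pd (e : OpenPartialHomeomorph M (EuclideanHalfSpace n)) (i : Fin n) (u : M → ℝ) (x : M) : ℝ :=
  fderivWithin ℝ (u ∘ (e.extend (𝓡∂ n)).symm) (Set.range (𝓡∂ n)) (e.extend (𝓡∂ n) x)
    (EuclideanSpace.single i 1)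

/-- The coordinate vector `∂ᵢ` at `x`: the tangent vector that the differential of the chart maps
to the `i`-th standard basis vector. -/
def frame (e : OpenPartialHomeomorph M (EuclideanHalfSpace n)) (i : Fin n) (x : M) :
    TangentSpace (𝓡∂ n) x :=
  (mfderiv (𝓡∂ n) 𝓘(ℝ, EuclideanSpace ℝ (Fin n)) (e.extend (𝓡∂ n)) x).inverse
    (EuclideanSpace.single i (1 : ℝ) : EuclideanSpace ℝ (Fin n))

variable [IsManifold (𝓡∂ n) ∞ M]

/-- The matrix `gᵢⱼ = g(∂ᵢ, ∂ⱼ)`. -/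
def gram (g : Metric n M) (e : OpenPartialHomeomorph M (EuclideanHalfSpace n)) (x : M) :
    Matrix (Fin n) (Fin n) ℝ :=
  Matrix.of fun i j => g.inner x (frame e i x) (frame e j x)

/-- The inverse matrix `gⁱʲ`. -/
def gramInv (g : Metric n M) (e : OpenPartialHomeomorph M (EuclideanHalfSpace n)) (x : M) :
    Matrix (Fin n) (Fin n) ℝ :=
  (gram g e x)⁻¹

/-- The Christoffel symbols of the Levi-Civita connection,
`Γᵏᵢⱼ = ½ gᵏˡ (∂ᵢ gⱼₗ + ∂ⱼ gᵢₗ - ∂ₗ gᵢⱼ)`. -/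
def christoffel (g : Metric n M) (e : OpenPartialHomeomorph M (EuclideanHalfSpace n))
    (k i j : Fin n) (x : M) : ℝ :=
  (1 / 2 : ℝ) * ∑ l, gramInv g e x k l *
    (pd e i (fun z => gram g e z j l) x + pd e j (fun z => gram g e z i l) x
      - pd e l (fun z => gram g e z i j) x)

/-- The Ricci tensor,
`Ricᵢⱼ = ∂ₖ Γᵏᵢⱼ - ∂ⱼ Γᵏᵢₖ + Γᵏₖₗ Γˡᵢⱼ - Γᵏⱼₗ Γˡᵢₖ`. -/
def ricci (g : Metric n M) (e : OpenPartialHomeomorph M (EuclideanHalfSpace n))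
    (i j : Fin n) (x : M) : ℝ :=
  ∑ k, (pd e k (christoffel g e k i j) x - pd e j (christoffel g e k i k) x)
    + ∑ k, ∑ l, (christoffel g e k k l x * christoffel g e l i j x
      - christoffel g e k j l x * christoffel g e l i k x)

/-- The Hessian, `(Hess f)ᵢⱼ = ∂ᵢ ∂ⱼ f - Γᵏᵢⱼ ∂ₖ f`. -/
def hess (g : Metric n M) (e : OpenPartialHomeomorph M (EuclideanHalfSpace n))
    (f : M → ℝ) (i j : Fin n) (x : M) : ℝ :=
  pd e i (pd e j f) x - ∑ k, christoffel g e k i j x * pd e k f x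

/-- The Laplacian, the trace of the Hessian, `Δ f = gⁱʲ (Hess f)ᵢⱼ`. -/
def laplacian (g : Metric n M) (e : OpenPartialHomeomorph M (EuclideanHalfSpace n))
    (f : M → ℝ) (x : M) : ℝ :=
  ∑ i, ∑ j, gramInv g e x i j * hess g e f i j x

/-- The components `νᵏ = - gᵏ⁰ / √g⁰⁰` of the outward unit normal at a boundary point. There, the
manifold is `{y 0 ≥ 0}` in the chart and `∂ᵢ`, `i ≠ 0`, span the tangent space of the boundary;
as `g(ν, ∂ᵢ) = - δ⁰ᵢ / √g⁰⁰`, this `ν` is orthogonal to the boundary, has length one, and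
`ν⁰ = - √g⁰⁰ < 0`. -/
def normal (g : Metric n M) (e : OpenPartialHomeomorph M (EuclideanHalfSpace n))
    (k : Fin n) (x : M) : ℝ :=
  -(gramInv g e x k 0) / Real.sqrt (gramInv g e x 0 0)

/-- The outward normal derivative `∂f/∂ν` at a boundary point. -/
def normalDeriv (g : Metric n M) (e : OpenPartialHomeomorph M (EuclideanHalfSpace n))
    (f : M → ℝ) (x : M) : ℝ :=
  ∑ k, normal g e k x * pd e k f x

/-- The second fundamental form of the boundary with respect to the outward unit normal,
`IIᵢⱼ = g(∇_{∂ᵢ} ν, ∂ⱼ) = - g(∇_{∂ᵢ} ∂ⱼ, ν) = - Γᵏᵢⱼ gₖₗ νˡ`, used for indices `i, j ≠ 0`. -/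
def secondFF (g : Metric n M) (e : OpenPartialHomeomorph M (EuclideanHalfSpace n))
    (i j : Fin n) (x : M) : ℝ :=
  -∑ k, ∑ l, christoffel g e k i j x * gram g e x k l * normal g e l x

/-- `Ric = 0` on `M`. -/
def IsRicciFlat (g : Metric n M) : Prop :=
  ∀ e : Chart n M, ∀ x ∈ e.1.source, ∀ i j, ricci g e.1 i j x = 0

/-- The boundary is totally geodesic: `II = 0` on `∂M`. -/
def HasTotallyGeodesicBoundary (g : Metric n M) : Prop :=
  ∀ e : Chart n M, ∀ x ∈ e.1.source ∩ (𝓡∂ n).boundary M, ∀ i j, i ≠ 0 → j ≠ 0 →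
    secondFF g e.1 i j x = 0

variable (n M) in
/-- Covariant 2-tensor fields on `M`, given by their components in every chart. -/
abbrev Tensor2 :=
  ∀ e : Chart n M, e.1.source → Fin n → Fin n → ℝ

variable (n M) in
/-- Covariant 2-tensor fields on `∂M`, given by their components, in every chart of `M`, with
respect to the coordinate vectors `∂ᵢ`, `i ≠ 0`, tangent to the boundary. -/
abbrev BdryTensor2 :=
  ∀ e : Chart n M, ↥(e.1.source ∩ (𝓡∂ n).boundary M) →
    {i : Fin n // i ≠ 0} → {i : Fin n // i ≠ 0} → ℝ

/-- `A_g^* f = -(Δ f) g + Hess f - f Ric`. -/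
def adjointInt (g : Metric n M) (f : M → ℝ) : Tensor2 n M := fun e x i j =>
  -(laplacian g e.1 f x) * gram g e.1 x i j + hess g e.1 f i j x - f x * ricci g e.1 i j x

/-- `B_γ^* f = (∂f/∂ν) γ - f II`, where `γ` is the metric induced on the boundary. -/
def adjointBdry (g : Metric n M) (f : M → ℝ) : BdryTensor2 n M := fun e x i j =>
  normalDeriv g e.1 f x * gram g e.1 x i j - f x * secondFF g e.1 i j x

/-- The operator `S_g^* f = (A_g^* f, B_γ^* f)` on smooth functions. -/
def adjointOp (g : Metric n M) (f : C^∞⟮𝓡∂ n, M; 𝓘(ℝ, ℝ), ℝ⟯) : Tensor2 n M × BdryTensor2 n M :=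
  (adjointInt g f, adjointBdry g f)

/-- The kernel of `S_g^*`. -/
def kerAdjoint (g : Metric n M) : Set C^∞⟮𝓡∂ n, M; 𝓘(ℝ, ℝ), ℝ⟯ :=
  {f | adjointOp g f = 0}

end RiemBdry

end

open Bundle Set Topology

/-! ### Regularity and positivity of the metric components in the charts `chartAt` -/

namespace RiemBdry

variable {n : ℕ} [NeZero n] {M : Type*} [TopologicalSpace M]
  [ChartedSpace (EuclideanHalfSpace n) M] [IsManifold (𝓡∂ n) ∞ M]

/-! All derivatives of a constant `c` vanish, so `S_g^*` sends it to `-(c Ric, c II)`. Hence the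
constants lie in the kernel as soon as `Ric = 0` and `II = 0`, and conversely `f = 1` in the kernel
forces both.

It remains to see that, when `Ric = 0` and `II = 0`, every `f` in the kernel is constant. The
interior equation becomes `Hess f = (Δ f) g`; its trace is `Δ f = n Δ f`, so `Hess f = 0` because `n
≥ 2` (`hess_eq_zero`). The boundary equation becomes `(∂f/∂ν) γ = 0`, so `∂f/∂ν = 0`, again because
`n ≥ 2`.

No integration is needed. By compactness `f` has a maximum, and `df` vanishes there even on the
boundary, thanks to the Neumann condition (`pd_eq_zero_of_forall_le`). Since `df` is parallel, its
zeros propagate along coordinate segments by Grönwall (`exists_mem_nhds_eq_of_pd_eq_zero`), and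
connectedness finishes the proof (`exists_forall_eq_of_hess_eq_zero`). -/

theorem frame_chartAt_eq_symmL (p : M) {x : M} (hx : x ∈ (chartAt (EuclideanHalfSpace n) p).source)
    (i : Fin n) :
    frame (chartAt (EuclideanHalfSpace n) p) i x =
      (trivializationAt (EuclideanSpace ℝ (Fin n)) (TangentSpace (𝓡∂ n)) p).symmL ℝ x
        (EuclideanSpace.single i (1 : ℝ)) := by
  have : IsManifold (𝓡∂ n) 1 M := IsManifold.of_le (n := ∞) (by simp)
  have h := TangentBundle.continuousLinearMapAt_trivializationAt (I := 𝓡∂ n) hx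
  have hb : x ∈ (trivializationAt (EuclideanSpace ℝ (Fin n)) (TangentSpace (𝓡∂ n)) p).baseSet := by
    simpa using hx
  let L := (trivializationAt (EuclideanSpace ℝ (Fin n))
    (TangentSpace (𝓡∂ n)) p).continuousLinearEquivAt ℝ x hb
  have hL : (L : TangentSpace (𝓡∂ n) x →L[ℝ] EuclideanSpace ℝ (Fin n)) =
      (trivializationAt (EuclideanSpace ℝ (Fin n))
        (TangentSpace (𝓡∂ n)) p).continuousLinearMapAt ℝ x := by
    ext1 v
    exact congrFun (Trivialization.coe_continuousLinearEquivAt_eq _ hb) v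
  refine (congrArg (fun T : TangentSpace (𝓡∂ n) x →L[ℝ] EuclideanSpace ℝ (Fin n) =>
    T.inverse (EuclideanSpace.single i (1 : ℝ))) (hL.trans h).symm).trans ?_
  simp only [ContinuousLinearMap.inverse_equiv]
  exact congrFun (Trivialization.symm_continuousLinearEquivAt_eq _ hb) _

/-- The coordinate vectors form the local frame of the tangent bundle trivialization at `p`, so they
are smooth sections, and a smooth metric is evaluated on them. -/
theorem contMDiffOn_gram (g : Metric n M) (p : M) (i j : Fin n) :
    ContMDiffOn (𝓡∂ n) 𝓘(ℝ, ℝ) ∞ (fun x => gram g (chartAt (EuclideanHalfSpace n) p) x i j)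
      (chartAt (EuclideanHalfSpace n) p).source := by
  have hf : ∀ i : Fin n, ContMDiffOn (𝓡∂ n) ((𝓡∂ n).prod 𝓘(ℝ, EuclideanSpace ℝ (Fin n))) ∞
      (fun x : M => TotalSpace.mk' (EuclideanSpace ℝ (Fin n)) x
        (frame (chartAt (EuclideanHalfSpace n) p) i x))
      (chartAt (EuclideanHalfSpace n) p).source := by
    intro i
    have h := (trivializationAt (EuclideanSpace ℝ (Fin n)) (TangentSpace (𝓡∂ n))
      p).contMDiffOn_localFrame_baseSet (I := 𝓡∂ n) ∞
        (EuclideanSpace.basisFun (Fin n) ℝ).toBasis i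
    rw [TangentBundle.trivializationAt_baseSet] at h
    refine h.congr fun x hx => ?_
    have hb : x ∈ (trivializationAt (EuclideanSpace ℝ (Fin n))
      (TangentSpace (𝓡∂ n)) p).baseSet := by simpa using hx
    rw [Trivialization.localFrame_apply_of_mem_baseSet _ _ hb, frame_chartAt_eq_symmL p hx]
    simpa [Trivialization.basisAt] using Trivialization.symmL_apply (R := ℝ) _ hb _
  have h := ContMDiffOn.clm_bundle_apply₂ (F₁ := EuclideanSpace ℝ (Fin n))
    (F₂ := EuclideanSpace ℝ (Fin n)) (F₃ := ℝ) (E₃ := Bundle.Trivial M ℝ)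
    g.contMDiff.contMDiffOn (hf i) (hf j)
  intro x hx
  have hx := h x hx
  simp only [contMDiffWithinAt_totalSpace] at hx
  exact hx.2

theorem posDef_gram (g : Metric n M) (p : M) {x : M}
    (hx : x ∈ (chartAt (EuclideanHalfSpace n) p).source) :
    (gram g (chartAt (EuclideanHalfSpace n) p) x).PosDef := by
  refine Matrix.PosDef.of_dotProduct_mulVec_pos ?_ fun v hv => ?_
  · ext i j
    simp [gram, g.symm x]
  · have hb : x ∈ (trivializationAt (EuclideanSpace ℝ (Fin n)) (TangentSpace (𝓡∂ n)) p).baseSet := by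
      simpa using hx
    set w := ∑ i, v i • frame (chartAt (EuclideanHalfSpace n) p) i x with hw
    have hwL : w = (trivializationAt (EuclideanSpace ℝ (Fin n)) (TangentSpace (𝓡∂ n)) p).symmL ℝ x
        (WithLp.toLp 2 v) := by
      have : (WithLp.toLp 2 v : EuclideanSpace ℝ (Fin n)) =
          ∑ i, v i • EuclideanSpace.single i (1 : ℝ) := by
        ext k
        simp [Finset.sum_apply, Pi.single_apply]
      rw [this, map_sum, hw]
      exact Finset.sum_congr rfl fun i _ => by rw [frame_chartAt_eq_symmL p hx, map_smul]
    have hw0 : w ≠ 0 := by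
      intro h0
      have h1 := (trivializationAt (EuclideanSpace ℝ (Fin n))
        (TangentSpace (𝓡∂ n)) p).continuousLinearMapAt_symmL (R := ℝ) hb (WithLp.toLp 2 v)
      rw [← hwL, h0, map_zero] at h1
      apply hv
      have := congrArg WithLp.ofLp h1
      simpa using this.symm
    refine (g.pos x w hw0).trans_eq ?_
    simp [hw, gram, dotProduct, Matrix.mulVec, map_sum, Finset.mul_sum]
    refine Finset.sum_congr rfl fun i _ => Finset.sum_congr rfl fun j _ => ?_
    rw [mul_comm (v j), g.symm x]

theorem contDiffOn_comp_extChartAt_symm (p : M) {u : M → ℝ}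
    (hu : ContMDiffOn (𝓡∂ n) 𝓘(ℝ, ℝ) ∞ u (chartAt (EuclideanHalfSpace n) p).source) :
    ContDiffOn ℝ ∞ (u ∘ (extChartAt (𝓡∂ n) p).symm) (extChartAt (𝓡∂ n) p).target := by
  rw [← contMDiffOn_iff_contDiffOn]
  refine hu.comp (contMDiffOn_extChartAt_symm p) fun y hy => ?_
  simpa using (extChartAt (𝓡∂ n) p).map_target hy

theorem contMDiffOn_pd (p : M) (i : Fin n) {u : M → ℝ}
    (hu : ContMDiffOn (𝓡∂ n) 𝓘(ℝ, ℝ) ∞ u (chartAt (EuclideanHalfSpace n) p).source) :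
    ContMDiffOn (𝓡∂ n) 𝓘(ℝ, ℝ) ∞ (pd (chartAt (EuclideanHalfSpace n) p) i u)
      (chartAt (EuclideanHalfSpace n) p).source := by
  have hd : ContDiffOn ℝ ∞ (fun y => fderivWithin ℝ (u ∘ (extChartAt (𝓡∂ n) p).symm)
      (range (𝓡∂ n)) y (EuclideanSpace.single i 1)) (extChartAt (𝓡∂ n) p).target := by
    -- The chart target is relatively open in the half-space, so derivatives within either set
    -- agree; smoothness is known on the target.
    refine ContDiffOn.congr (f := fun y => fderivWithin ℝ (u ∘ (extChartAt (𝓡∂ n) p).symm)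
      (extChartAt (𝓡∂ n) p).target y (EuclideanSpace.single i 1)) ?_ fun y hy => ?_
    · exact ((contDiffOn_comp_extChartAt_symm p hu).fderivWithin (uniqueDiffOn_extChartAt_target p)
        (by simp)).clm_apply contDiffOn_const
    · rw [fderivWithin_of_mem_nhdsWithin (extChartAt_target_mem_nhdsWithin_of_mem hy)
        ((𝓡∂ n).uniqueDiffOn y (extChartAt_target_subset_range p hy))
        ((contDiffOn_comp_extChartAt_symm p hu).differentiableOn (by simp) y hy)]
  have h := (contMDiffOn_iff_contDiffOn.2 hd).comp
    (contMDiffOn_extChartAt (I := 𝓡∂ n) (x := p) (n := ∞))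
    fun y hy => (extChartAt (𝓡∂ n) p).map_source (by simpa using hy)
  exact h

theorem continuousOn_gramInv (g : Metric n M) (p : M) (i j : Fin n) :
    ContinuousOn (fun x => gramInv g (chartAt (EuclideanHalfSpace n) p) x i j)
      (chartAt (EuclideanHalfSpace n) p).source := by
  have hG : ContinuousOn (gram g (chartAt (EuclideanHalfSpace n) p))
      (chartAt (EuclideanHalfSpace n) p).source :=
    continuousOn_pi.2 fun i => continuousOn_pi.2 fun j => (contMDiffOn_gram g p i j).continuousOn
  simp only [gramInv, Matrix.inv_def, Ring.inverse_eq_inv', Matrix.smul_apply, smul_eq_mul]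
  refine ContinuousOn.mul (ContinuousOn.inv₀ ?_ fun x hx => (posDef_gram g p hx).det_pos.ne') ?_
  · exact (continuous_id.matrix_det).comp_continuousOn hG
  · exact ((continuous_id.matrix_adjugate).matrix_elem i j).comp_continuousOn hG

theorem continuousOn_christoffel (g : Metric n M) (p : M) (k i j : Fin n) :
    ContinuousOn (christoffel g (chartAt (EuclideanHalfSpace n) p) k i j)
      (chartAt (EuclideanHalfSpace n) p).source := by
  unfold christoffel
  refine continuousOn_const.mul (continuousOn_finsetSum _ fun l _ =>
    (continuousOn_gramInv g p k l).mul ?_)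
  exact ((contMDiffOn_pd p i (contMDiffOn_gram g p j l)).continuousOn.add
    (contMDiffOn_pd p j (contMDiffOn_gram g p i l)).continuousOn).sub
    (contMDiffOn_pd p l (contMDiffOn_gram g p i j)).continuousOn

end RiemBdry

/-! ### Grönwall on segments, constants, the trace argument and critical maxima -/

namespace RiemBdry

/-- A map on a convex set whose differential is bounded by a multiple of its norm vanishes
identically as soon as it vanishes at one point. -/
theorem eq_zero_of_norm_fderivWithin_le {E F : Type*} [NormedAddCommGroup E] [NormedSpace ℝ E]
    [NormedAddCommGroup F] [NormedSpace ℝ F] {s : Set E} (hs : Convex ℝ s) {V : E → F}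
    {V' : E → E →L[ℝ] F} {C : ℝ} (hV : ∀ y ∈ s, HasFDerivWithinAt V (V' y) s y)
    (hC : ∀ y ∈ s, ‖V' y‖ ≤ C * ‖V y‖) {z w : E} (hz : z ∈ s) (hw : w ∈ s) (h0 : V z = 0) :
    V w = 0 := by
  have hmem : ∀ t ∈ Icc (0 : ℝ) 1, AffineMap.lineMap z w t ∈ s := fun t ht =>
    hs.lineMap_mem hz hw ht
  have hd : ∀ t ∈ Icc (0 : ℝ) 1, HasDerivWithinAt (V ∘ AffineMap.lineMap z w)
      (V' (AffineMap.lineMap z w t) (w - z)) (Icc 0 1) t := fun t ht =>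
    (hV _ (hmem t ht)).comp_hasDerivWithinAt t AffineMap.hasDerivWithinAt_lineMap hmem
  -- Along the segment from `z` to `w` the bound reads `‖φ'‖ ≤ C ‖w - z‖ ‖φ‖` with `φ 0 = 0`, so
  -- Grönwall applies.
  have h := eq_zero_of_abs_deriv_le_mul_abs_self_of_eq_zero_right (K := C * ‖w - z‖)
    (fun t ht => (hd t ht).continuousWithinAt)
    (fun t ht => (hd t (Ico_subset_Icc_self ht)).mono_of_mem_nhdsWithin
      (Icc_mem_nhdsGE_of_mem ht)) (by simpa using h0)
    (fun t ht => ?_) 1 (by simp)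
  · simpa using h
  · calc ‖V' (AffineMap.lineMap z w t) (w - z)‖
        ≤ ‖V' (AffineMap.lineMap z w t)‖ * ‖w - z‖ := ContinuousLinearMap.le_opNorm _ _
      _ ≤ C * ‖V (AffineMap.lineMap z w t)‖ * ‖w - z‖ := by
          gcongr; exact hC _ (hmem t (Ico_subset_Icc_self ht))
      _ = _ := by simp only [Function.comp]; ring

/-- An operator on `ℝⁿ` is bounded by the sum of the norms of its values on the standard basis. -/
theorem norm_le_sum_norm_apply_single {n : ℕ} {F : Type*} [NormedAddCommGroup F] [NormedSpace ℝ F]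
    (L : EuclideanSpace ℝ (Fin n) →L[ℝ] F) :
    ‖L‖ ≤ ∑ i, ‖L (EuclideanSpace.single i 1)‖ := by
  refine L.opNorm_le_bound (Finset.sum_nonneg fun _ _ => norm_nonneg _) fun x => ?_
  have hx : x = ∑ i, x i • EuclideanSpace.single i (1 : ℝ) := by
    ext k
    simp [Finset.sum_apply, Pi.single_apply]
  conv_lhs => rw [hx, map_sum]
  rw [Finset.sum_mul]
  refine (norm_sum_le _ _).trans (Finset.sum_le_sum fun i _ => ?_)
  rw [map_smul, norm_smul, mul_comm]
  gcongr
  exact PiLp.norm_apply_le x i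

variable {n : ℕ} [NeZero n] {M : Type*} [TopologicalSpace M]

theorem pd_const (e : OpenPartialHomeomorph M (EuclideanHalfSpace n)) (i : Fin n) (c : ℝ) (x : M) :
    pd e i (fun _ => c) x = 0 := by
  simp [pd, Function.comp_def]

variable [ChartedSpace (EuclideanHalfSpace n) M] [IsManifold (𝓡∂ n) ∞ M]

theorem hess_const (g : Metric n M) (e : OpenPartialHomeomorph M (EuclideanHalfSpace n))
    (c : ℝ) (i j : Fin n) (x : M) : hess g e (fun _ => c) i j x = 0 := by
  have : pd e j (fun _ => c) = fun _ => 0 := funext fun x => pd_const e j c x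
  simp [hess, this, pd_const]

theorem adjointInt_const (g : Metric n M) (c : ℝ) (e : Chart n M) (x : e.1.source) (i j : Fin n) :
    adjointInt g (fun _ => c) e x i j = -(c * ricci g e.1 i j x) := by
  simp [adjointInt, laplacian, hess_const]

theorem adjointBdry_const (g : Metric n M) (c : ℝ) (e : Chart n M)
    (x : ↥(e.1.source ∩ (𝓡∂ n).boundary M)) (i j : {i : Fin n // i ≠ 0}) :
    adjointBdry g (fun _ => c) e x i j = -(c * secondFF g e.1 i j x) := by
  simp [adjointBdry, normalDeriv, pd_const]

theorem sum_gramInv_mul_gram (g : Metric n M) (p : M) {x : M}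
    (hx : x ∈ (chartAt (EuclideanHalfSpace n) p).source) :
    ∑ i, ∑ j, gramInv g (chartAt (EuclideanHalfSpace n) p) x i j *
      gram g (chartAt (EuclideanHalfSpace n) p) x i j = n := by
  have hG := posDef_gram g p hx
  have h1 : gramInv g (chartAt (EuclideanHalfSpace n) p) x *
      gram g (chartAt (EuclideanHalfSpace n) p) x = 1 :=
    Matrix.nonsing_inv_mul _ hG.det_pos.ne'.isUnit
  have h2 := congrArg Matrix.trace h1
  rw [Matrix.trace_one, Fintype.card_fin] at h2
  rw [← h2]
  simp only [Matrix.trace, Matrix.diag, Matrix.mul_apply]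
  refine Finset.sum_congr rfl fun i _ => Finset.sum_congr rfl fun j _ => ?_
  simp [gram, g.symm x]

/-- Taking the trace of `Hess f = (Δ f) g` gives `Δ f = 0` in dimension at least two, hence
`Hess f = 0`. -/
theorem hess_eq_zero (hn : 2 ≤ n) (g : Metric n M) (p : M) (f : M → ℝ) {x : M}
    (hx : x ∈ (chartAt (EuclideanHalfSpace n) p).source)
    (h : ∀ i j, hess g (chartAt (EuclideanHalfSpace n) p) f i j x =
      laplacian g (chartAt (EuclideanHalfSpace n) p) f x *
        gram g (chartAt (EuclideanHalfSpace n) p) x i j) (i j : Fin n) :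
    hess g (chartAt (EuclideanHalfSpace n) p) f i j x = 0 := by
  have h1 : laplacian g (chartAt (EuclideanHalfSpace n) p) f x =
      laplacian g (chartAt (EuclideanHalfSpace n) p) f x * n := by
    rw [← sum_gramInv_mul_gram g p hx, Finset.mul_sum]
    conv_lhs => rw [laplacian]
    refine Finset.sum_congr rfl fun i _ => ?_
    rw [Finset.mul_sum]
    refine Finset.sum_congr rfl fun j _ => ?_
    rw [h]; ring
  have h2 : (2 : ℝ) ≤ n := by exact_mod_cast hn
  have h3 : laplacian g (chartAt (EuclideanHalfSpace n) p) f x = 0 := by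
    have : laplacian g (chartAt (EuclideanHalfSpace n) p) f x * (n - 1) = 0 := by linarith
    exact (mul_eq_zero.1 this).resolve_right (by linarith)
  rw [h, h3, zero_mul]

/-- A maximum point of a function with vanishing normal derivative on the boundary is critical. -/
theorem pd_eq_zero_of_forall_le (g : Metric n M) (f : M → ℝ) (p : M) (hp : ∀ x, f x ≤ f p)
    (hb : p ∈ (𝓡∂ n).boundary M →
      normalDeriv g (chartAt (EuclideanHalfSpace n) p) f p = 0) (i : Fin n) :
    pd (chartAt (EuclideanHalfSpace n) p) i f p = 0 := by
  set y := extChartAt (𝓡∂ n) p p with hy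
  have hyR : y ∈ range (𝓡∂ n) := extChartAt_target_subset_range p (mem_extChartAt_target p)
  have hmax : IsLocalMaxOn (f ∘ (extChartAt (𝓡∂ n) p).symm) (range (𝓡∂ n)) y :=
    Filter.Eventually.of_forall fun z => by
      simpa only [Function.comp_apply, hy, extChartAt_to_inv] using hp _
  -- If `v` and `-v` both point into the half-space at `y`, the two one-sided inequalities at a
  -- maximum force the derivative along `v` to vanish.
  have hcrit : ∀ v : EuclideanSpace ℝ (Fin n),
      (∀ᶠ t : ℝ in 𝓝 0, y + t • v ∈ range (𝓡∂ n)) →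
      fderivWithin ℝ (f ∘ (extChartAt (𝓡∂ n) p).symm) (range (𝓡∂ n)) y v = 0 := by
    intro v hv
    refine hmax.fderivWithin_eq_zero (mem_posTangentConeAt_of_frequently_mem ?_)
      (mem_posTangentConeAt_of_frequently_mem ?_)
    · exact (hv.filter_mono nhdsWithin_le_nhds).frequently
    · have : Filter.Tendsto (fun t : ℝ => -t) (𝓝 0) (𝓝 0) := by
        simpa using (continuous_neg (G := ℝ)).tendsto 0
      have := (this.eventually hv).filter_mono (nhdsWithin_le_nhds (s := Ioi 0))
      simpa using this.frequently
  rw [range_modelWithCornersEuclideanHalfSpace] at hyR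
  change 0 ≤ y 0 at hyR
  rcases hyR.eq_or_lt with h0 | h0
  -- At a boundary point, moving along `∂ₖ` with `k ≠ 0` keeps coordinate `0` equal to zero.
  · have htan : ∀ k : Fin n, k ≠ 0 → pd (chartAt (EuclideanHalfSpace n) p) k f p = 0 := by
      intro k hk
      refine hcrit _ (Filter.Eventually.of_forall fun t => ?_)
      rw [range_modelWithCornersEuclideanHalfSpace]
      simp [← h0, hk.symm]
    have hbd : p ∈ (𝓡∂ n).boundary M := by
      change extChartAt (𝓡∂ n) p p ∈ frontier (range (𝓡∂ n))
      rw [frontier_range_modelWithCornersEuclideanHalfSpace]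
      exact h0
    by_cases hi : i = 0
    · subst hi
      have h1 := hb hbd
      -- Only `ν⁰ ∂₀f` survives in `∂f/∂ν`, and `ν⁰ = -√g⁰⁰` is nonzero.
      rw [normalDeriv, Finset.sum_eq_single 0 (fun k _ hk => by rw [htan k hk, mul_zero])
        (by simp)] at h1
      refine (mul_eq_zero.1 h1).resolve_left ?_
      have hpos : 0 < gramInv g (chartAt (EuclideanHalfSpace n) p) p 0 0 :=
        (posDef_gram g p (mem_chart_source _ p)).inv.diag_pos
      exact div_ne_zero (neg_ne_zero.2 hpos.ne') (Real.sqrt_pos.2 hpos).ne'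
    · exact htan i hi
  · refine hcrit _ ?_
    rw [range_modelWithCornersEuclideanHalfSpace]
    have : Continuous fun t : ℝ => (y + t • EuclideanSpace.single i (1 : ℝ)) 0 := by fun_prop
    have := (this.tendsto 0).eventually (lt_mem_nhds (a := 0) (by simpa using h0))
    exact this.mono fun t ht => ht.le

end RiemBdry

/-! ### Rigidity of functions with vanishing Hessian -/

namespace RiemBdry

variable {n : ℕ} [NeZero n] {M : Type*} [TopologicalSpace M]
  [ChartedSpace (EuclideanHalfSpace n) M]

theorem fderivWithin_comp_extChartAt_symm_single (p : M) (u : M → ℝ)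
    {y : EuclideanSpace ℝ (Fin n)} (hy : y ∈ (extChartAt (𝓡∂ n) p).target) (i : Fin n) :
    fderivWithin ℝ (u ∘ (extChartAt (𝓡∂ n) p).symm) (range (𝓡∂ n)) y (EuclideanSpace.single i 1) =
      pd (chartAt (EuclideanHalfSpace n) p) i u ((extChartAt (𝓡∂ n) p).symm y) := by
  change _ = fderivWithin ℝ (u ∘ (extChartAt (𝓡∂ n) p).symm) (range (𝓡∂ n))
    (extChartAt (𝓡∂ n) p ((extChartAt (𝓡∂ n) p).symm y)) (EuclideanSpace.single i 1)
  rw [(extChartAt (𝓡∂ n) p).right_inv hy]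

theorem pd_eq_zero_of_eventually_eq (p : M) {f : M → ℝ} {z : M}
    (hz : z ∈ (chartAt (EuclideanHalfSpace n) p).source) {c : ℝ} (h : ∀ᶠ w in 𝓝 z, f w = c)
    (i : Fin n) : pd (chartAt (EuclideanHalfSpace n) p) i f z = 0 := by
  have hz' : z ∈ (extChartAt (𝓡∂ n) p).source := by simpa using hz
  have ht : Filter.Tendsto (extChartAt (𝓡∂ n) p).symm (𝓝[range (𝓡∂ n)] (extChartAt (𝓡∂ n) p z))
      (𝓝 z) := by
    have := (continuousOn_extChartAt_symm (I := 𝓡∂ n) p _ ((extChartAt (𝓡∂ n) p).map_source hz'))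
      |>.mono_of_mem_nhdsWithin (extChartAt_target_mem_nhdsWithin' hz')
    rwa [ContinuousWithinAt, (extChartAt (𝓡∂ n) p).left_inv hz'] at this
  have he : f ∘ (extChartAt (𝓡∂ n) p).symm =ᶠ[𝓝[range (𝓡∂ n)] (extChartAt (𝓡∂ n) p z)]
      (fun _ => c) := ht.eventually h
  have h1 := he.fderivWithin_eq (𝕜 := ℝ) (by
    rw [Function.comp_apply, (extChartAt (𝓡∂ n) p).left_inv hz']
    exact h.self_of_nhds)
  change fderivWithin ℝ (f ∘ (extChartAt (𝓡∂ n) p).symm) (range (𝓡∂ n)) (extChartAt (𝓡∂ n) p z)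
    (EuclideanSpace.single i 1) = 0
  rw [h1]
  simp

variable [IsManifold (𝓡∂ n) ∞ M]

theorem hasFDerivWithinAt_comp_extChartAt_symm (p : M) {u : M → ℝ}
    (hu : ContMDiffOn (𝓡∂ n) 𝓘(ℝ, ℝ) ∞ u (chartAt (EuclideanHalfSpace n) p).source)
    {y : EuclideanSpace ℝ (Fin n)} (hy : y ∈ (extChartAt (𝓡∂ n) p).target) :
    HasFDerivWithinAt (u ∘ (extChartAt (𝓡∂ n) p).symm)
      (fderivWithin ℝ (u ∘ (extChartAt (𝓡∂ n) p).symm) (range (𝓡∂ n)) y) (range (𝓡∂ n)) y :=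
  (((contDiffOn_comp_extChartAt_symm p hu).differentiableOn (by simp) y hy).mono_of_mem_nhdsWithin
    (extChartAt_target_mem_nhdsWithin_of_mem hy)).hasFDerivWithinAt

/-- A function with vanishing Hessian and a critical point close to `p` is constant near `p`, on a
neighbourhood that does not depend on the critical point: its differential solves a linear first-order system. -/
theorem exists_mem_nhds_eq_of_pd_eq_zero (g : Metric n M) {f : M → ℝ}
    (hf : ContMDiff (𝓡∂ n) 𝓘(ℝ, ℝ) ∞ f) (p : M)
    (hess0 : ∀ x ∈ (chartAt (EuclideanHalfSpace n) p).source, ∀ i j,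
      hess g (chartAt (EuclideanHalfSpace n) p) f i j x = 0) :
    ∃ U ∈ 𝓝 p, ∀ z ∈ U, (∀ i, pd (chartAt (EuclideanHalfSpace n) p) i f z = 0) →
      ∀ w ∈ U, f w = f z := by
  set e := chartAt (EuclideanHalfSpace n) p with he
  set E := extChartAt (𝓡∂ n) p with hE
  have hpd : ∀ j, ContMDiffOn (𝓡∂ n) 𝓘(ℝ, ℝ) ∞ (pd e j f) e.source := fun j =>
    contMDiffOn_pd p j hf.contMDiffOn
  have hsymm : ∀ y ∈ E.target, E.symm y ∈ e.source := fun y hy => by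
    simpa [hE, he] using E.map_target hy
  -- `B` dominates every Christoffel sum below; by continuity it stays under `B (E p) + 1` on a
  -- small half-ball, chosen before any critical point.
  let B : EuclideanSpace ℝ (Fin n) → ℝ := fun y =>
    ∑ i, ∑ j, ∑ k, |christoffel g e k i j (E.symm y)|
  have hB : ContinuousOn B E.target := by
    refine continuousOn_finsetSum _ fun i _ => continuousOn_finsetSum _ fun j _ =>
      continuousOn_finsetSum _ fun k _ => ?_
    exact ((continuousOn_christoffel g p k i j).comp (continuousOn_extChartAt_symm p) hsymm).abs
  obtain ⟨r, hr, hrS⟩ : ∃ r > 0, Metric.ball (E p) r ∩ range (𝓡∂ n) ⊆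
      E.target ∩ {y | B y ≤ B (E p) + 1} := by
    refine Metric.mem_nhdsWithin_iff.1 (Filter.inter_mem (extChartAt_target_mem_nhdsWithin p) ?_)
    have h1 : ContinuousWithinAt B (range (𝓡∂ n)) (E p) :=
      (hB _ (mem_extChartAt_target p)).mono_of_mem_nhdsWithin (extChartAt_target_mem_nhdsWithin p)
    exact (h1.eventually (gt_mem_nhds (lt_add_one _))).mono fun y hy => hy.le
  set S := Metric.ball (E p) r ∩ range (𝓡∂ n) with hS
  have hSR : S ⊆ range (𝓡∂ n) := inter_subset_right
  have hSconv : Convex ℝ S := by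
    refine (convex_ball _ _).inter ?_
    rw [range_modelWithCornersEuclideanHalfSpace]
    exact EuclideanHalfSpace.convex
  -- `V` collects the components of `df`. By `Hess f = 0` it solves `∂ᵢ Vⱼ = Γᵏᵢⱼ Vₖ`, which yields
  -- the Grönwall bound on the convex set `S`.
  let V : EuclideanSpace ℝ (Fin n) → Fin n → ℝ := fun y j => pd e j f (E.symm y)
  let V' : EuclideanSpace ℝ (Fin n) → EuclideanSpace ℝ (Fin n) →L[ℝ] Fin n → ℝ := fun y =>
    ContinuousLinearMap.pi fun j => fderivWithin ℝ (pd e j f ∘ E.symm) (range (𝓡∂ n)) y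
  have hV : ∀ y ∈ S, HasFDerivWithinAt V (V' y) S y := fun y hy =>
    hasFDerivWithinAt_pi.2 fun j =>
      (hasFDerivWithinAt_comp_extChartAt_symm p (hpd j) (hrS hy).1).mono hSR
  have hVbound : ∀ y ∈ S, ‖V' y‖ ≤ (n * (B (E p) + 1)) * ‖V y‖ := by
    intro y hy
    have hB0 : 0 ≤ B y := by positivity
    have hBy : B y ≤ B (E p) + 1 := (hrS hy).2
    have hi : ∀ i, ‖V' y (EuclideanSpace.single i 1)‖ ≤ (B (E p) + 1) * ‖V y‖ := by
      intro i
      refine (pi_norm_le_iff_of_nonneg (by positivity)).2 fun j => ?_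
      have h1 : V' y (EuclideanSpace.single i 1) j =
          ∑ k, christoffel g e k i j (E.symm y) * V y k := by
        have h2 := hess0 _ (hsymm y (hrS hy).1) i j
        rw [hess, sub_eq_zero] at h2
        rw [← h2]
        exact fderivWithin_comp_extChartAt_symm_single p (pd e j f) (hrS hy).1 i
      have h3 : ∑ k, |christoffel g e k i j (E.symm y)| ≤ B y :=
        (Finset.single_le_sum (f := fun j => ∑ k, |christoffel g e k i j (E.symm y)|)
          (fun _ _ => by positivity) (Finset.mem_univ j)).trans
        (Finset.single_le_sum (f := fun i => ∑ j, ∑ k, |christoffel g e k i j (E.symm y)|)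
          (fun _ _ => by positivity) (Finset.mem_univ i))
      rw [h1]
      calc ‖∑ k, christoffel g e k i j (E.symm y) * V y k‖
          ≤ ∑ k, |christoffel g e k i j (E.symm y)| * ‖V y‖ := by
            refine (norm_sum_le _ _).trans (Finset.sum_le_sum fun k _ => ?_)
            rw [norm_mul, Real.norm_eq_abs]
            gcongr
            exact norm_le_pi_norm (V y) k
        _ ≤ (B (E p) + 1) * ‖V y‖ := by
            rw [← Finset.sum_mul]
            gcongr
            exact h3.trans hBy
    calc ‖V' y‖ ≤ ∑ i, ‖V' y (EuclideanSpace.single i 1)‖ := norm_le_sum_norm_apply_single _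
      _ ≤ ∑ _i : Fin n, (B (E p) + 1) * ‖V y‖ := Finset.sum_le_sum fun i _ => hi i
      _ = _ := by simp [mul_assoc]
  have hSnhds : S ∈ 𝓝[range (𝓡∂ n)] (E p) :=
    Filter.inter_mem (mem_nhdsWithin_of_mem_nhds (Metric.ball_mem_nhds _ hr)) self_mem_nhdsWithin
  refine ⟨E.source ∩ E ⁻¹' S, Filter.inter_mem (extChartAt_source_mem_nhds p)
    (extChartAt_preimage_mem_nhds_of_mem_nhdsWithin (mem_extChartAt_source p) hSnhds),
    fun z hz hz0 w hw => ?_⟩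
  have hVz : V (E z) = 0 := funext fun j => by
    simp only [V, E.left_inv hz.1, hz0, Pi.zero_apply]
  have hVS : ∀ y ∈ S, V y = 0 := fun y hy =>
    eq_zero_of_norm_fderivWithin_le hSconv hV hVbound hz.2 hy hVz
  have hdF : ∀ y ∈ S, HasFDerivWithinAt (fun y => (f ∘ E.symm) y - f z)
      (fderivWithin ℝ (f ∘ E.symm) (range (𝓡∂ n)) y) S y := fun y hy =>
    ((hasFDerivWithinAt_comp_extChartAt_symm p hf.contMDiffOn (hrS hy).1).mono hSR).sub_const _
  -- With `V = 0` on `S`, the differential of `f - f z` vanishes there, so `C = 0` suffices.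
  have hF := eq_zero_of_norm_fderivWithin_le (C := 0) hSconv hdF (fun y hy => ?_) hz.2 hw.2
    (by simp [E.left_inv hz.1])
  · simpa [E.left_inv hw.1, sub_eq_zero] using hF
  · refine (norm_le_sum_norm_apply_single _).trans ?_
    rw [zero_mul]
    refine Finset.sum_nonpos fun i _ => ?_
    rw [fderivWithin_comp_extChartAt_symm_single p f (hrS hy).1 i]
    exact (norm_eq_zero.2 (congrFun (hVS y hy) i)).le

/-- On a compact connected manifold, a function with vanishing Hessian and vanishing normal
derivative on the boundary is constant. -/
theorem exists_forall_eq_of_hess_eq_zero [CompactSpace M] [ConnectedSpace M] (g : Metric n M)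
    {f : M → ℝ} (hf : ContMDiff (𝓡∂ n) 𝓘(ℝ, ℝ) ∞ f)
    (hess0 : ∀ p : M, ∀ x ∈ (chartAt (EuclideanHalfSpace n) p).source, ∀ i j,
      hess g (chartAt (EuclideanHalfSpace n) p) f i j x = 0)
    (hb : ∀ p ∈ (𝓡∂ n).boundary M, normalDeriv g (chartAt (EuclideanHalfSpace n) p) f p = 0) :
    ∃ c : ℝ, ∀ x, f x = c := by
  obtain ⟨p, -, hp⟩ := isCompact_univ.exists_isMaxOn univ_nonempty hf.continuous.continuousOn
  -- Asking for equality near `x`, not just at `x`, makes `W` open at once and all its points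
  -- critical.
  let W : Set M := {x | ∀ᶠ z in 𝓝 x, f z = f p}
  have hWo : IsOpen W := isOpen_iff_mem_nhds.2 fun x hx => eventually_eventually_nhds.2 hx
  have hWc : IsClosed W := by
    refine isClosed_of_closure_subset fun x hx => ?_
    -- `U` depends only on the limit point `x`, so it meets `W` at some critical `z`, and `f = f z =
    -- f p` on all of `U`.
    obtain ⟨U, hU, hUf⟩ := exists_mem_nhds_eq_of_pd_eq_zero g hf x (hess0 x)
    obtain ⟨z, ⟨hzU, hzs⟩, hzW⟩ := mem_closure_iff_nhds.1 hx _
      (Filter.inter_mem hU (chart_source_mem_nhds (EuclideanHalfSpace n) x))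
    have hz : f z = f p := hzW.self_of_nhds
    filter_upwards [hU] with w hw
    rw [hUf z hzU (pd_eq_zero_of_eventually_eq x hzs hzW) w hw, hz]
  have hWp : p ∈ W := by
    obtain ⟨U, hU, hUf⟩ := exists_mem_nhds_eq_of_pd_eq_zero g hf p (hess0 p)
    filter_upwards [hU] with w hw
    exact hUf p (mem_of_mem_nhds hU)
      (pd_eq_zero_of_forall_le g f p (fun x => hp (mem_univ x)) (hb p)) w hw
  have hW : W = univ := IsClopen.eq_univ ⟨hWc, hWo⟩ ⟨p, hWp⟩
  refine ⟨f p, fun x => ?_⟩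
  have hx : ∀ᶠ z in 𝓝 x, f z = f p := show x ∈ W from hW ▸ mem_univ x
  exact hx.self_of_nhds

end RiemBdry

/-! ### The equivalence -/

theorem proposition3p3 {n : ℕ} [NeZero n] (hn : 2 ≤ n) {M : Type*} [TopologicalSpace M]
    [T2Space M] [CompactSpace M] [ConnectedSpace M]
    [ChartedSpace (EuclideanHalfSpace n) M] [IsManifold (𝓡∂ n) ∞ M]
    (g : RiemBdry.Metric n M) :
    (RiemBdry.IsRicciFlat g ∧ RiemBdry.HasTotallyGeodesicBoundary g) ↔
      RiemBdry.kerAdjoint g = {f | ∃ c : ℝ, ∀ x, f x = c} := by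
  constructor
  · rintro ⟨hR, hII⟩
    ext f
    constructor
    · intro hf
      have hA : RiemBdry.adjointInt g f = 0 := congrArg Prod.fst hf
      have hB : RiemBdry.adjointBdry g f = 0 := congrArg Prod.snd hf
      let e : M → RiemBdry.Chart n M := fun p => ⟨chartAt _ p, IsManifold.chart_mem_maximalAtlas p⟩
      refine RiemBdry.exists_forall_eq_of_hess_eq_zero g f.contMDiff (fun p x hx => ?_) fun p hp => ?_
      · refine RiemBdry.hess_eq_zero hn g p f hx fun i j => ?_
        have h1 : RiemBdry.adjointInt g f (e p) ⟨x, hx⟩ i j = 0 := by rw [hA]; rfl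
        have h2 : RiemBdry.ricci g (chartAt (EuclideanHalfSpace n) p) i j x = 0 := hR (e p) x hx i j
        simp only [RiemBdry.adjointInt, e, h2] at h1
        linarith
      -- Since `n ≥ 2`, the boundary has a tangent direction `∂₁`; dividing by `γ₁₁ > 0` gives
      -- `∂f/∂ν = 0`.
      · let k : Fin n := ⟨1, hn⟩
        have hk : k ≠ 0 := fun h => by simpa [k] using congrArg Fin.val h
        have hs := mem_chart_source (EuclideanHalfSpace n) p
        have h1 : RiemBdry.adjointBdry g f (e p) ⟨p, hs, hp⟩ ⟨k, hk⟩ ⟨k, hk⟩ = 0 := by rw [hB]; rfl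
        have h2 : RiemBdry.secondFF g (chartAt (EuclideanHalfSpace n) p) k k p = 0 :=
          hII (e p) p ⟨hs, hp⟩ k k hk hk
        simp only [RiemBdry.adjointBdry, e, h2, mul_zero, sub_zero] at h1
        exact (mul_eq_zero.1 h1).resolve_right (RiemBdry.posDef_gram g p hs).diag_pos.ne'
    · rintro ⟨c, hc⟩
      have hfc : (f : M → ℝ) = fun _ => c := funext hc
      refine Prod.ext ?_ ?_
      · funext e x i j
        change RiemBdry.adjointInt g f e x i j = 0
        rw [hfc, RiemBdry.adjointInt_const, hR e x x.2, mul_zero, neg_zero]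
      · funext e x i j
        change RiemBdry.adjointBdry g f e x i j = 0
        rw [hfc, RiemBdry.adjointBdry_const, hII e x x.2 i j i.2 j.2, mul_zero, neg_zero]
  · intro h
    let one : C^∞⟮𝓡∂ n, M; 𝓘(ℝ, ℝ), ℝ⟯ := ⟨fun _ => 1, contMDiff_const⟩
    have h1 : one ∈ RiemBdry.kerAdjoint g := h ▸ ⟨1, fun _ => rfl⟩
    have hA : RiemBdry.adjointInt g (fun _ => 1) = 0 := congrArg Prod.fst h1
    have hB : RiemBdry.adjointBdry g (fun _ => 1) = 0 := congrArg Prod.snd h1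
    refine ⟨fun e x hx i j => ?_, fun e x hx i j hi hj => ?_⟩
    · have h2 := RiemBdry.adjointInt_const g 1 e ⟨x, hx⟩ i j
      rw [hA] at h2
      simpa using h2.symm
    · have h2 := RiemBdry.adjointBdry_const g 1 e ⟨x, hx⟩ ⟨i, hi⟩ ⟨j, hj⟩
      rw [hB] at h2
      simpa using h2.symm
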